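/- An additively idempotent semiring (ai-semiring) is a nonempty set $S$ with two binary operations $+,\cdot$ such that $(S,+)$ is a commutative idempotent semigroup, $(S,\cdot)$ is a semigroup, and $x(y+z)=xy+xz$ and $(x+y)z=xz+yz$ for all $x,y,z\in S$. A variety (of ai-semirings) is a class of ai-semirings closed under subalgebras, homomorphic images and arbitrary direct products; $\mathsf V(K)$ denotes the smallest variety containing a class $K$. A variety is finitely based if it is the class of all ai-semirings satisfying some finite set of identities; it is finitely generated if it equals $\mathsf V(K)$ for some finite set $K$ of finite ai-semirings; it is a Cross variety if it is finitely based, finitely generated, and has only finitely many subvarieties. Let $\mathbf R$ be the variety of all ai-semirings satisfying the identity $xy\approx xz$. Then $\mathbf R$ is a Cross variety. Consequently, every subvariety of $\mathbf R$ is both finitely based and finitely generated; in particular, for every ai-semiring $S$ satisfying $xy\approx xz$, the variety $\mathsf V(S)$ generated by $S$ is both finitely based and finitely generated. -/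

import Mathlib

universe u v

namespace AiVar

/-- An additively idempotent semiring: `(S, +)` is a commutative idempotent semigroup, `(S, *)` is
a semigroup, and both distributive laws hold. No neutral or zero elements are required. -/
class AiSemiring (S : Type u) extends AddCommSemigroup S, Semigroup S, Distrib S where
  add_idem : ∀ x : S, x + x = x

/-- Pointwise operations on a direct product. -/
instance piAiSemiring {I : Type v} (S : I → Type u) [∀ i, AiSemiring (S i)] :
    AiSemiring (∀ i, S i) where
  add_assoc _ _ _ := funext fun _ => add_assoc _ _ _
  add_comm _ _ := funext fun _ => add_comm _ _
  mul_assoc _ _ _ := funext fun _ => mul_assoc _ _ _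
  left_distrib _ _ _ := funext fun _ => left_distrib _ _ _
  right_distrib _ _ _ := funext fun _ => right_distrib _ _ _
  add_idem _ := funext fun _ => AiSemiring.add_idem _

/-- Homomorphisms of ai-semirings. -/
structure IsHom {S : Type u} {T : Type v} [AiSemiring S] [AiSemiring T] (f : S → T) : Prop where
  map_add : ∀ x y, f (x + y) = f x + f y
  map_mul : ∀ x y, f (x * y) = f x * f y

/-- Bundled (nonempty) ai-semirings. -/
structure AiAlg : Type (u + 1) where
  carrier : Type u
  [str : AiSemiring carrier]
  [nonempty : Nonempty carrier]

attribute [instance] AiAlg.str AiAlg.nonempty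

/-- The direct product of a family of ai-semirings. -/
def AiAlg.prod {I : Type u} (A : I → AiAlg.{u}) : AiAlg.{u} where
  carrier := ∀ i, (A i).carrier

/-- Terms in the two binary operations, over the countably infinite set of variables `ℕ`. -/
inductive AiTerm : Type where
  | var : ℕ → AiTerm
  | add : AiTerm → AiTerm → AiTerm
  | mul : AiTerm → AiTerm → AiTerm

/-- The value of a term under an assignment of the variables. -/
def AiTerm.eval {S : Type u} [AiSemiring S] (a : ℕ → S) : AiTerm → S
  | .var n => a n
  | .add s t => s.eval a + t.eval a
  | .mul s t => s.eval a * t.eval a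

theorem AiTerm.map_eval {S : Type u} {T : Type v} [AiSemiring S] [AiSemiring T] {f : S → T}
    (hf : IsHom f) (a : ℕ → S) (t : AiTerm) : f (t.eval a) = t.eval (fun n => f (a n)) := by
  induction t with
  | var n => rfl
  | add s t hs ht => simp only [AiTerm.eval, hf.map_add, hs, ht]
  | mul s t hs ht => simp only [AiTerm.eval, hf.map_mul, hs, ht]

/-- An identity `s ≈ t`. -/
structure Identity : Type where
  lhs : AiTerm
  rhs : AiTerm

/-- `S` satisfies the identity `e`: both sides agree under every assignment of the variables. -/
def Satisfies (S : Type u) [AiSemiring S] (e : Identity) : Prop :=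
  ∀ a : ℕ → S, e.lhs.eval a = e.rhs.eval a

/-- A variety of ai-semirings: a class of ai-semirings that is closed under subalgebras (up to
isomorphism, i.e. under embeddings), homomorphic images, and arbitrary direct products. -/
@[ext]
structure Variety : Type (u + 1) where
  carrier : Set AiAlg.{u}
  sub_mem : ∀ (A B : AiAlg.{u}) (f : A.carrier → B.carrier),
    IsHom f → Function.Injective f → B ∈ carrier → A ∈ carrier
  image_mem : ∀ (A B : AiAlg.{u}) (f : A.carrier → B.carrier),
    IsHom f → Function.Surjective f → A ∈ carrier → B ∈ carrier
  prod_mem : ∀ (I : Type u) (A : I → AiAlg.{u}),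
    (∀ i, A i ∈ carrier) → AiAlg.prod A ∈ carrier

namespace Variety

/-- `W ≤ V`: `W` is a subvariety of `V`. -/
instance : LE Variety.{u} := ⟨fun W V => W.carrier ⊆ V.carrier⟩

/-- The variety of all ai-semirings satisfying the identities in `E`. -/
def ofIdentities (E : Set Identity) : Variety.{u} where
  carrier := {A | ∀ e ∈ E, Satisfies A.carrier e}
  sub_mem A B f hf hi hB e he a := hi <| by
    rw [AiTerm.map_eval hf, AiTerm.map_eval hf]
    exact hB e he _
  image_mem A B f hf hs hA e he b := by
    obtain ⟨g, hg⟩ := hs.hasRightInverse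
    have h := congrArg f (hA e he (fun n => g (b n)))
    rw [AiTerm.map_eval hf, AiTerm.map_eval hf] at h
    simpa only [hg _] using h
  prod_mem I A hA e he a := by
    funext i
    have hp : IsHom (fun x : (AiAlg.prod A).carrier => x i) := ⟨fun _ _ => rfl, fun _ _ => rfl⟩
    have h1 := AiTerm.map_eval hp a e.lhs
    have h2 := AiTerm.map_eval hp a e.rhs
    exact h1.trans ((hA i e he _).trans h2.symm)

/-- `V(K)`: the variety generated by `K`, the smallest variety containing the class `K`. -/
def generate (K : Set AiAlg.{u}) : Variety.{u} where
  carrier := {A | ∀ V : Variety.{u}, K ⊆ V.carrier → A ∈ V.carrier}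
  sub_mem A B f hf hi hB V hV := V.sub_mem A B f hf hi (hB V hV)
  image_mem A B f hf hs hA V hV := V.image_mem A B f hf hs (hA V hV)
  prod_mem I A hA V hV := V.prod_mem I A fun i => hA i V hV

/-- `V` can be defined by finitely many identities. (The axioms of ai-semirings, which are
themselves finitely many identities, are built into `ofIdentities`.) -/
def FinitelyBased (V : Variety.{u}) : Prop :=
  ∃ E : Set Identity, E.Finite ∧ V = ofIdentities E

/-- `V` is generated by finitely many finite algebras. -/
def FinitelyGenerated (V : Variety.{u}) : Prop :=
  ∃ K : Set AiAlg.{u}, K.Finite ∧ (∀ A ∈ K, Finite A.carrier) ∧ V = generate K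

/-- Cross varieties: finitely based, finitely generated, with finitely many subvarieties. -/
structure IsCross (V : Variety.{u}) : Prop where
  finitelyBased : V.FinitelyBased
  finitelyGenerated : V.FinitelyGenerated
  finite_subvarieties : {W : Variety.{u} | W ≤ V}.Finite

/-- The variety **R** of all ai-semirings satisfying `xy ≈ xz`. -/
def R : Variety.{u} :=
  ofIdentities {⟨.mul (.var 0) (.var 1), .mul (.var 0) (.var 2)⟩}

end Variety

end AiVar

namespace AiVar

/-! If `xy ≈ xz`, a monomial of degree at least two equals the square of its leftmost variable, so a
term is a join of variables and squares. An identity thus splits into inequalities `x ≤ t` or `x² ≤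
t`. Identifying variables (`exists_retraction`) reduces each to an equivalent one in three
variables, and there are only finitely many of those. By a Birkhoff argument (`mem_of_forall_holds`)
they determine a subvariety of **R**. This gives a finite basis and finitely many subvarieties.
Finite generators arise because an inequality fails already in a finitely generated subalgebra,
which is finite. -/

/-- The natural order of the additive semilattice: `x ≤ y` iff `x + y = y`. -/
instance AiSemiring.instPartialOrder {S : Type u} [AiSemiring S] : PartialOrder S where
  le x y := x + y = y
  le_refl := AiSemiring.add_idem
  le_trans x y z (hxy : x + y = y) (hyz : y + z = z) := by
    rw [← hyz, ← add_assoc, hxy]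
  le_antisymm x y (hxy : x + y = y) (hyx : y + x = x) := by
    rw [← hxy, add_comm, hyx]

namespace AiSemiring

variable {S : Type u} [AiSemiring S]

theorem le_def {x y : S} : x ≤ y ↔ x + y = y := Iff.rfl

theorem add_le_iff {x y z : S} : x + y ≤ z ↔ x ≤ z ∧ y ≤ z := by
  simp only [le_def]
  constructor
  · intro h
    constructor
    · rw [← h, ← add_assoc, ← add_assoc, add_idem]
    · rw [← h, ← add_assoc, ← add_assoc, add_comm y x, add_assoc x y y, add_idem]
  · rintro ⟨hx, hy⟩
    rw [add_assoc, hy, hx]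

end AiSemiring

/-! ### Normal form of terms -/

/-- Terms over an arbitrary set `X` of variables. -/
inductive Term (X : Type v) : Type v where
  | var : X → Term X
  | add : Term X → Term X → Term X
  | mul : Term X → Term X → Term X

namespace Term

variable {X : Type v} {S : Type u} [AiSemiring S]

/-- The value of a term under an assignment of the variables. -/
def eval (e : X → S) : Term X → S
  | .var x => e x
  | .add s t => s.eval e + t.eval e
  | .mul s t => s.eval e * t.eval e

/-- The variables that occur as leftmost factors of the monomials of a term. -/
def heads : Term X → Set X
  | .var x => {x}
  | .add s t => s.heads ∪ t.heads
  | .mul s _ => s.heads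

/-- The variables that occur as monomials of degree one of a term. -/
def linear : Term X → Set X
  | .var x => {x}
  | .add s t => s.linear ∪ t.linear
  | .mul _ _ => ∅

/-- The variables that occur as leftmost factors of the monomials of degree at least two. -/
def nonlinear : Term X → Set X
  | .var _ => ∅
  | .add s t => s.nonlinear ∪ t.nonlinear
  | .mul s _ => s.heads

theorem map_eval {T : Type*} [AiSemiring T] {f : S → T} (hf : IsHom f) (e : X → S) (t : Term X) :
    f (t.eval e) = t.eval (fun x => f (e x)) := by
  induction t with
  | var x => rfl
  | add s t hs ht => simp only [eval, hf.map_add, hs, ht]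
  | mul s t hs ht => simp only [eval, hf.map_mul, hs, ht]

/-- Right distributivity reduces to monomials, where `x * c = x * x`. Associativity pushes further
factors into `c`, hence the generalization over `c`. -/
theorem eval_mul_le_iff (hS : ∀ x y z : S, x * y = x * z) (e : X → S) (t : Term X) (c u : S) :
    t.eval e * c ≤ u ↔ ∀ x ∈ t.heads, e x * e x ≤ u := by
  induction t generalizing c with
  | var x => simp [eval, heads, hS (e x) c (e x)]
  | add s t hs ht =>
    simp only [eval, heads, right_distrib, AiSemiring.add_le_iff, hs, ht, Set.mem_union, or_imp, forall_and]
  | mul s t hs ht => simp only [eval, heads, mul_assoc, hs]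

/-- The value of a term is the join of the values of its monomials. -/
theorem eval_le_iff (hS : ∀ x y z : S, x * y = x * z) (e : X → S) (t : Term X) (u : S) :
    t.eval e ≤ u ↔ (∀ x ∈ t.linear, e x ≤ u) ∧ ∀ x ∈ t.nonlinear, e x * e x ≤ u := by
  induction t with
  | var x => simp [eval, linear, nonlinear]
  | add s t hs ht =>
    simp only [eval, linear, nonlinear, AiSemiring.add_le_iff, hs, ht, Set.mem_union, or_imp, forall_and]
    tauto
  | mul s t hs ht => simp [eval, linear, nonlinear, eval_mul_le_iff hS]

theorem eval_eq_of_monomials_eq (hS : ∀ x y z : S, x * y = x * z) (e : X → S) {s t : Term X}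
    (hl : s.linear = t.linear) (hn : s.nonlinear = t.nonlinear) : s.eval e = t.eval e := by
  apply le_antisymm
  · rw [eval_le_iff hS, hl, hn, ← eval_le_iff hS]
  · rw [eval_le_iff hS, ← hl, ← hn, ← eval_le_iff hS]

end Term

/-! ### Generated subalgebras -/

/-- The subalgebra generated by a family of elements. -/
def Generated {X : Type v} {S : Type u} [AiSemiring S] (e : X → S) : Type u :=
  {d : S // ∃ t : Term X, t.eval e = d}

namespace Generated

variable {X : Type v} {S : Type u} [AiSemiring S] (e : X → S)

instance : AiSemiring (Generated e) where
  add a b := ⟨a.1 + b.1, by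
    obtain ⟨s, hs⟩ := a.2
    obtain ⟨t, ht⟩ := b.2
    exact ⟨s.add t, by rw [Term.eval, hs, ht]⟩⟩
  mul a b := ⟨a.1 * b.1, by
    obtain ⟨s, hs⟩ := a.2
    obtain ⟨t, ht⟩ := b.2
    exact ⟨s.mul t, by rw [Term.eval, hs, ht]⟩⟩
  add_assoc _ _ _ := Subtype.ext (add_assoc _ _ _)
  add_comm _ _ := Subtype.ext (add_comm _ _)
  mul_assoc _ _ _ := Subtype.ext (mul_assoc _ _ _)
  left_distrib _ _ _ := Subtype.ext (left_distrib _ _ _)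
  right_distrib _ _ _ := Subtype.ext (right_distrib _ _ _)
  add_idem _ := Subtype.ext (AiSemiring.add_idem _)

/-- The generators. -/
def of (x : X) : Generated e := ⟨e x, .var x, rfl⟩

instance [Nonempty X] : Nonempty (Generated e) := ⟨of e (Classical.arbitrary X)⟩

theorem isHom_val : IsHom (fun a : Generated e => a.1) := ⟨fun _ _ => rfl, fun _ _ => rfl⟩

theorem le_iff {a b : Generated e} : a ≤ b ↔ a.1 ≤ b.1 := Subtype.ext_iff

/-- An element is determined by the two variable sets of a term representing it. -/
theorem finite [Finite X] (hS : ∀ x y z : S, x * y = x * z) : Finite (Generated e) := by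
  choose t ht using fun a : Generated e => a.2
  refine Finite.of_injective (fun a => ((t a).linear, (t a).nonlinear)) fun a b hab => ?_
  obtain ⟨hl, hn⟩ := Prod.mk.inj hab
  exact Subtype.ext ((ht a).symm.trans ((Term.eval_eq_of_monomials_eq hS e hl hn).trans (ht b)))

end Generated

/-! ### Inequalities in three variables -/

/-- An inequality in at most three variables between a monomial in the variable `0` (the variable
itself or its square) and a sum of variables and of squares of variables. -/
structure Inequality : Type where
  isLinear : Bool
  linear : Set (Fin 3)
  squares : Set (Fin 3)

namespace Inequality

instance : Finite Inequality :=
  Finite.of_injective (fun φ => (φ.isLinear, φ.linear, φ.squares)) fun φ ψ h => by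
    cases φ; cases ψ; simpa using h

/-- `φ` holds in `S`: every upper bound of the right-hand side is one of the left-hand side. -/
def Holds (φ : Inequality) (S : Type u) [AiSemiring S] : Prop :=
  ∀ (e : Fin 3 → S) (d : S), (∀ i ∈ φ.linear, e i ≤ d) → (∀ i ∈ φ.squares, e i * e i ≤ d) →
    bif φ.isLinear then e 0 ≤ d else e 0 * e 0 ≤ d

/-- The left-hand side of the inequality as a term. -/
def lower (φ : Inequality) : AiTerm :=
  bif φ.isLinear then .var 0 else .mul (.var 0) (.var 0)

/-- The summands of the right-hand side of the inequality. -/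
noncomputable def summands (φ : Inequality) : List AiTerm :=
  φ.linear.toFinite.toFinset.toList.map (fun i => .var i.val) ++
    φ.squares.toFinite.toFinset.toList.map (fun i => .mul (.var i.val) (.var i.val))

/-- The right-hand side of the inequality, with an additional variable as a summand. -/
noncomputable def upper (φ : Inequality) : AiTerm :=
  φ.summands.foldr .add (.var 3)

/-- The identity that expresses the inequality. -/
noncomputable def identity (φ : Inequality) : Identity :=
  ⟨.add φ.lower φ.upper, φ.upper⟩

end Inequality

theorem AiTerm.eval_foldr_add_le_iff {S : Type u} [AiSemiring S] (a : ℕ → S) (l : List AiTerm)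
    (b : AiTerm) (u : S) :
    (l.foldr .add b).eval a ≤ u ↔ (∀ t ∈ l, t.eval a ≤ u) ∧ b.eval a ≤ u := by
  induction l with
  | nil => simp
  | cons t l ih => simp [AiTerm.eval, AiSemiring.add_le_iff, ih, and_assoc]

namespace Inequality

variable {S : Type u} [AiSemiring S]

theorem eval_upper_le_iff (φ : Inequality) (a : ℕ → S) (u : S) :
    φ.upper.eval a ≤ u ↔ ((∀ i ∈ φ.linear, a i.val ≤ u) ∧
      ∀ i ∈ φ.squares, a i.val * a i.val ≤ u) ∧ a 3 ≤ u := by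
  simp [upper, summands, AiTerm.eval_foldr_add_le_iff, AiTerm.eval, and_assoc]

/-- The extra variable `3` plays the role of the bound `d`; it keeps the right-hand side meaningful
when both sets are empty, as no zero is available. -/
theorem satisfies_identity_iff (φ : Inequality) : Satisfies S φ.identity ↔ φ.Holds S := by
  constructor
  · intro h e d hl hs
    let a : ℕ → S := fun n => if hn : n < 3 then e ⟨n, hn⟩ else d
    have ha : ∀ i : Fin 3, a i.val = e i := fun i => by simp [a]
    have hle : φ.lower.eval a ≤ φ.upper.eval a := h a
    have hd := hle.trans ((φ.eval_upper_le_iff a d).2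
      ⟨by simpa only [ha] using And.intro hl hs, le_of_eq (by simp [a])⟩)
    have h0 : a 0 = e 0 := ha 0
    unfold lower at hd
    cases hb : φ.isLinear <;> simpa [hb, AiTerm.eval, h0] using hd
  · intro h a
    obtain ⟨⟨hl, hs⟩, -⟩ := (φ.eval_upper_le_iff a _).1 le_rfl
    have hd := h (fun i => a i.val) (φ.upper.eval a) hl hs
    change φ.lower.eval a ≤ φ.upper.eval a
    unfold lower
    cases hb : φ.isLinear <;> simpa [hb, AiTerm.eval] using hd

end Inequality

/-- For sets `L`, `Q` and an element `x` there is a map to `X` that fixes `x`, preserves `L` and `Q`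
and factors through three elements. -/
theorem exists_retraction {X : Type v} (L Q : Set X) (x : X) :
    ∃ (g : X → Fin 3) (h : Fin 3 → X), g x = 0 ∧ h 0 = x ∧
      (∀ a ∈ L, h (g a) ∈ L) ∧ ∀ a ∈ Q, h (g a) ∈ Q := by
  classical
  by_cases hw : ∃ w, w ∈ L ∧ w ∈ Q
  -- A common element `w` can absorb everything except `x`.
  · obtain ⟨w, hL, hQ⟩ := hw
    refine ⟨fun a => if a = x then 0 else 1, ![x, w, w], by simp, rfl, ?_, ?_⟩ <;>
    · intro a ha
      by_cases hax : a = x <;> simp_all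
  -- For disjoint `L` and `Q`, each collapses to a representative of its own; for an empty set the
  -- value `x` is arbitrary.
  · obtain ⟨l, hl⟩ : ∃ l, ∀ a ∈ L, l ∈ L := by
      by_cases hL : L.Nonempty
      · exact ⟨hL.some, fun _ _ => hL.some_mem⟩
      · exact ⟨x, fun a ha => (hL ⟨a, ha⟩).elim⟩
    obtain ⟨q, hq⟩ : ∃ q, ∀ a ∈ Q, q ∈ Q := by
      by_cases hQ : Q.Nonempty
      · exact ⟨hQ.some, fun _ _ => hQ.some_mem⟩
      · exact ⟨x, fun a ha => (hQ ⟨a, ha⟩).elim⟩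
    refine ⟨fun a => if a = x then 0 else if a ∈ L then 1 else 2, ![x, l, q], by simp, rfl, ?_, ?_⟩
    · intro a ha
      by_cases hax : a = x
      · simpa [hax] using hax ▸ ha
      · simpa [hax, ha] using hl a ha
    · intro a ha
      have haL : a ∉ L := fun h => hw ⟨a, h, ha⟩
      by_cases hax : a = x
      · simpa [hax] using hax ▸ ha
      · simpa [hax, haL] using hq a ha

/-! ### Subvarieties of **R** -/

namespace Variety

theorem mem_R_iff {A : AiAlg.{u}} :
    A ∈ R.carrier ↔ ∀ x y z : A.carrier, x * y = x * z := by
  constructor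
  · intro h x y z
    have := h _ rfl (fun n => if n = 0 then x else if n = 1 then y else z)
    simpa [AiTerm.eval] using this
  · rintro h _ rfl a
    exact h _ _ _

theorem eval_le_of_forall_eval_eq {W : Variety.{u}} (hW : W ≤ R) {A : AiAlg.{u}}
    (hA : A ∈ R.carrier)
    (h : ∀ φ : Inequality, (∀ B ∈ W.carrier, φ.Holds B.carrier) → φ.Holds A.carrier)
    {X : Type u} {s t : Term X}
    (hst : ∀ B ∈ W.carrier, ∀ e : X → B.carrier, s.eval e = t.eval e) (e : X → A.carrier) :
    s.eval e ≤ t.eval e := by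
  have hA' := mem_R_iff.1 hA
  have key : ∀ (b : Bool) (x : X),
      (∀ B ∈ W.carrier, ∀ e : X → B.carrier,
        bif b then e x ≤ t.eval e else e x * e x ≤ t.eval e) →
      bif b then e x ≤ t.eval e else e x * e x ≤ t.eval e := by
    intro b x hx
    obtain ⟨g, r, hg, hr, hl, hn⟩ := exists_retraction t.linear t.nonlinear x
    obtain ⟨hel, hen⟩ := (Term.eval_le_iff hA' e t _).1 le_rfl
    -- Substituting along `g` gives an inequality valid in `W`; substituting back along `r` only
    -- uses summands already in `t`.
    have hφ := h ⟨b, g '' t.linear, g '' t.nonlinear⟩ (by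
      intro B hB c d hcl hcn
      have hd : t.eval (fun a => c (g a)) ≤ d :=
        (Term.eval_le_iff (mem_R_iff.1 (hW hB)) _ t d).2
          ⟨fun a ha => hcl _ ⟨a, ha, rfl⟩, fun a ha => hcn _ ⟨a, ha, rfl⟩⟩
      have hc := hx B hB (fun a => c (g a))
      rw [hg] at hc
      cases b
      · exact le_trans hc hd
      · exact le_trans hc hd) (fun i => e (r i)) (t.eval e)
      (by rintro _ ⟨a, ha, rfl⟩; exact hel _ (hl a ha))
      (by rintro _ ⟨a, ha, rfl⟩; exact hen _ (hn a ha))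
    rw [hr] at hφ
    exact hφ
  have hle : ∀ B ∈ W.carrier, ∀ c : X → B.carrier,
      (∀ x ∈ s.linear, c x ≤ t.eval c) ∧ ∀ x ∈ s.nonlinear, c x * c x ≤ t.eval c :=
    fun B hB c => (Term.eval_le_iff (mem_R_iff.1 (hW hB)) c s _).1 (hst B hB c).le
  exact (Term.eval_le_iff hA' e s _).2
    ⟨fun x hx => key true x fun B hB c => (hle B hB c).1 x hx,
      fun x hx => key false x fun B hB c => (hle B hB c).2 x hx⟩

/-- A subvariety of **R** contains every algebra of **R** in which the inequalities of the
subvariety hold. -/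
theorem mem_of_forall_holds {W : Variety.{u}} (hW : W ≤ R) {A : AiAlg.{u}} (hA : A ∈ R.carrier)
    (h : ∀ φ : Inequality, (∀ B ∈ W.carrier, φ.Holds B.carrier) → φ.Holds A.carrier) :
    A ∈ W.carrier := by
  -- One refuting algebra per identity failing in `W`: the family `p` in their product generates a
  -- relatively free algebra on the elements of `A`.
  let I : Type u := {p : Term A.carrier × Term A.carrier //
    ∃ B ∈ W.carrier, ∃ e : A.carrier → B.carrier, p.1.eval e ≠ p.2.eval e}
  choose B hB e he using fun i : I => i.2
  let P : AiAlg.{u} := AiAlg.prod B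
  have hP : P ∈ W.carrier := W.prod_mem I B hB
  let p : A.carrier → P.carrier := fun x i => e i x
  have hp : ∀ (t : Term A.carrier) (i : I), t.eval p i = t.eval (e i) := fun t i =>
    Term.map_eval (f := fun c : P.carrier => c i) ⟨fun _ _ => rfl, fun _ _ => rfl⟩ p t
  have heq : ∀ s t : Term A.carrier, s.eval p = t.eval p → s.eval id = t.eval id := by
    intro s t hst
    have hall : ∀ B ∈ W.carrier, ∀ e : A.carrier → B.carrier, s.eval e = t.eval e := by
      by_contra! hne
      exact he ⟨(s, t), hne⟩ (by rw [← hp, ← hp, hst])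
    exact le_antisymm (eval_le_of_forall_eval_eq hW hA h hall id)
      (eval_le_of_forall_eval_eq hW hA h (fun B hB c => (hall B hB c).symm) id)
  choose τ hτ using fun c : Generated p => c.2
  have hC : AiAlg.mk (Generated p) ∈ W.carrier :=
    W.sub_mem (AiAlg.mk (Generated p)) P Subtype.val (Generated.isHom_val p)
      Subtype.val_injective hP
  refine W.image_mem (AiAlg.mk (Generated p)) A (fun c => (τ c).eval id) ⟨?_, ?_⟩ ?_ hC
  · intro c d
    refine heq _ (.add (τ c) (τ d)) ?_
    rw [hτ, Term.eval, hτ, hτ]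
    rfl
  · intro c d
    refine heq _ (.mul (τ c) (τ d)) ?_
    rw [hτ, Term.eval, hτ, hτ]
    rfl
  · intro x
    exact ⟨Generated.of p x, heq _ (.var x) (hτ _)⟩

/-- The inequalities that hold in a variety. -/
def inequalities (W : Variety.{u}) : Set Inequality :=
  {φ | ∀ B ∈ W.carrier, φ.Holds B.carrier}

theorem le_of_inequalities_subset {V W : Variety.{u}} (hV : V ≤ R) (hW : W ≤ R)
    (h : W.inequalities ⊆ V.inequalities) : V ≤ W :=
  fun A hA => mem_of_forall_holds hW (hV hA) fun _ hφ => h hφ A hA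

theorem eq_of_le_of_le {V W : Variety.{u}} (h₁ : V ≤ W) (h₂ : W ≤ V) : V = W :=
  Variety.ext (Set.Subset.antisymm h₁ h₂)

theorem finitelyBased_of_le_R {W : Variety.{u}} (hW : W ≤ R) : W.FinitelyBased := by
  refine ⟨{⟨.mul (.var 0) (.var 1), .mul (.var 0) (.var 2)⟩} ∪
    Inequality.identity '' W.inequalities,
    (Set.finite_singleton _).union (Set.toFinite _), eq_of_le_of_le ?_ ?_⟩
  · rintro A hA e (he | ⟨φ, hφ, rfl⟩)
    · exact hW hA e he
    · exact φ.satisfies_identity_iff.2 (hφ A hA)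
  · intro A hA
    exact mem_of_forall_holds hW (fun e he => hA e (Or.inl he)) fun φ hφ =>
      φ.satisfies_identity_iff.1 (hA _ (Or.inr ⟨φ, hφ, rfl⟩))

/-- An inequality that fails in a subvariety of **R** fails in a finite member of it. -/
theorem exists_finite_not_holds {W : Variety.{u}} (hW : W ≤ R) {φ : Inequality}
    (hφ : φ ∉ W.inequalities) :
    ∃ B ∈ W.carrier, Finite B.carrier ∧ ¬ φ.Holds B.carrier := by
  simp only [inequalities, Set.mem_ofPred_eq, not_forall] at hφ
  obtain ⟨B, hB, hφ⟩ := hφ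
  simp only [Inequality.Holds, not_forall] at hφ
  obtain ⟨e, d, hl, hs, hfail⟩ := hφ
  -- The bound `d` must be a generator too, so that the failure survives in the subalgebra.
  let c : Option (Fin 3) → B.carrier := fun o => o.elim d e
  refine ⟨AiAlg.mk (Generated c), W.sub_mem (AiAlg.mk (Generated c)) B Subtype.val
    (Generated.isHom_val c) Subtype.val_injective hB,
    Generated.finite c (mem_R_iff.1 (hW hB)), fun h => hfail ?_⟩
  have := h (fun i => Generated.of c (some i)) (Generated.of c none)
    (fun i hi => (Generated.le_iff c).2 (hl i hi)) (fun i hi => (Generated.le_iff c).2 (hs i hi))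
  cases hb : φ.isLinear <;> rw [hb] at this
  · exact (Generated.le_iff c).1 this
  · exact (Generated.le_iff c).1 this

theorem generate_le {K : Set AiAlg.{u}} {V : Variety.{u}} (h : K ⊆ V.carrier) : generate K ≤ V :=
  fun _ hA => hA V h

theorem subset_generate (K : Set AiAlg.{u}) : K ⊆ (generate K).carrier :=
  fun _ hA _ hV => hV hA

/-- One finite witness for each of the finitely many failing inequalities generates a subvariety
with no further inequalities. -/
theorem finitelyGenerated_of_le_R {W : Variety.{u}} (hW : W ≤ R) : W.FinitelyGenerated := by
  choose B hB hfin hfail using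
    fun φ : {φ : Inequality // φ ∉ W.inequalities} => exists_finite_not_holds hW φ.2
  have hle : generate (Set.range B) ≤ W := generate_le (Set.range_subset_iff.2 hB)
  refine ⟨Set.range B, Set.finite_range B, Set.forall_mem_range.2 hfin, eq_of_le_of_le ?_ hle⟩
  refine le_of_inequalities_subset hW (fun A hA => hW (hle hA)) fun φ hφ => ?_
  by_contra hn
  exact hfail ⟨φ, hn⟩ (hφ _ (subset_generate _ ⟨_, rfl⟩))

theorem finite_setOf_le_R : {W : Variety.{u} | W ≤ R}.Finite := by
  refine Set.Finite.of_finite_image (f := inequalities) (Set.toFinite _) fun V hV W hW h => ?_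
  exact eq_of_le_of_le (le_of_inequalities_subset hV hW h.ge)
    (le_of_inequalities_subset hW hV h.le)

end Variety

end AiVar

theorem corollary2p8 :
    AiVar.Variety.IsCross AiVar.Variety.R.{u} ∧
    (∀ W : AiVar.Variety.{u}, W ≤ AiVar.Variety.R.{u} →
      W.FinitelyBased ∧ W.FinitelyGenerated) ∧
    (∀ (S : Type u) [AiVar.AiSemiring S] [Nonempty S], (∀ x y z : S, x * y = x * z) →
      (AiVar.Variety.generate {AiVar.AiAlg.mk S}).FinitelyBased ∧
      (AiVar.Variety.generate {AiVar.AiAlg.mk S}).FinitelyGenerated) := by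
  have h : ∀ W : AiVar.Variety.{u}, W ≤ AiVar.Variety.R.{u} →
      W.FinitelyBased ∧ W.FinitelyGenerated := fun W hW =>
    ⟨AiVar.Variety.finitelyBased_of_le_R hW, AiVar.Variety.finitelyGenerated_of_le_R hW⟩
  have hR : AiVar.Variety.R.{u} ≤ AiVar.Variety.R.{u} := fun _ hA => hA
  refine ⟨⟨(h _ hR).1, (h _ hR).2, AiVar.Variety.finite_setOf_le_R⟩, h, fun S _ _ hS => h _ ?_⟩
  exact AiVar.Variety.generate_le (Set.singleton_subset_iff.2 (AiVar.Variety.mem_R_iff.2 hS))
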